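/- Fix an integer $r\ge 1$ and let $s=2$. Lattice paths take unit steps east ($E$) and north ($N$) in $\mathbb Z^2$. Two points $v,w\in\mathbb Z^2$ are equivalent if $v-w=\ell(r,s)$ for some $\ell\in\mathbb Z$. A lattice path $P$ is valid if, whenever $P$ enters a point $v$ with an $E$-step, every later point of $P$ equivalent to $v$ is also entered with an $E$-step. For $n\ge 0$ let $\mathcal V_n$ be the set of valid lattice paths from $(0,0)$ to $(nr,2n)$. For $n\ge 2$ and $P\in\mathcal V_n$ define $\phi(P)=(P',Q')$ as follows, all paths being translated so as to start at the origin. Let $E^aNE^bN$ be the prefix of $P$ ending with its second $N$-step, and let $t$ be the number of $E$-steps of $P$ after its last $N$-step. (1) If $a+b+t\ge r$, let $c=r-a-b$, write $P=E^aNE^bN\,Q\,E^c$, and put $P'=E^aNE^bNE^c$, $Q'=Q$. (2) If $a+b+t<r$, let $c=t$, write $P=E^aNE^bN\,R\,E^{r+1}NE^c$, and put $P'=E^aNE^{r-a-c}NE^c$, $Q'=E^{a+b+c+1}N\,R$. For $n\ge 1$, let $\Phi(P)=(P_1',\dots,P_n')$ be the result of applying $\phi$ $n-1$ times, first to $P\in\mathcal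 V_n$ and then each time to the last component (so $\Phi(P)=(P)$ when $n=1$). Then, for every $n\ge 1$, the map $\Phi$ is a bijection $\mathcal V_n\to(\mathcal V_1)^n$, and for every $P\in\mathcal V_n$ the paths $P$ and $P_1'$ have the same number of $E$-steps before their first $N$-step. Moreover, for every integer $a$ with $0\le a\le r$, the number of $P\in\mathcal V_n$ that begin with $E^aN$ is $$(r-a+1)\binom{r+2}{2}^{n-1}.$$ -/

import Mathlib

namespace LatticePaths

/-- The two unit steps: `E` (east) and `N` (north). -/
inductive Step where
  | E : Step
  | N : Step
deriving DecidableEq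

/-- The displacement of a step in the integer plane. -/
def Step.vec : Step → ℤ × ℤ
  | Step.E => (1, 0)
  | Step.N => (0, 1)

/-- A (finite) lattice path starting at the origin, given by its sequence of steps. -/
abbrev LatticePath := List Step

/-- The vertex reached by `P` after its first `i` steps. -/
def LatticePath.vertex (P : LatticePath) (i : ℕ) : ℤ × ℤ :=
  ((P.take i).map Step.vec).sum

/-- The last vertex of `P`. -/
def LatticePath.endpoint (P : LatticePath) : ℤ × ℤ := P.vertex P.length

/-- Two points are equivalent if their difference is an integer multiple of `(r, s)`. -/
def SameClass (r s : ℕ) (v w : ℤ × ℤ) : Prop :=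
  ∃ l : ℤ, v - w = l • ((r : ℤ), (s : ℤ))

/-- `P` enters the point `v` with the step `x`, this being the step number `i`
(counted from `0`) of `P`. -/
def LatticePath.EntersAt (P : LatticePath) (i : ℕ) (v : ℤ × ℤ) (x : Step) : Prop :=
  P[i]? = some x ∧ P.vertex (i + 1) = v

/-- Whenever `P` enters a point `v` with an `E`-step, every later point of `P` in the class
of `v` is entered with an `E`-step. -/
def LatticePath.Valid (r s : ℕ) (P : LatticePath) : Prop :=
  ∀ (i j : ℕ) (v w : ℤ × ℤ) (x : Step), i < j →
    P.EntersAt i v Step.E → P.EntersAt j w x → SameClass r s w v → x = Step.E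

/-- The set of all valid lattice paths from `(0, 0)` to `(n r, n s)`. -/
def validPaths (r s n : ℕ) : Set LatticePath :=
  {P | P.endpoint = ((n : ℤ) * r, (n : ℤ) * s) ∧ P.Valid r s}

/-- The number of `E`-steps of `P` before its first `N`-step. -/
def initialE (P : LatticePath) : ℕ := (P.takeWhile (· = Step.E)).length

/-- The number of `E`-steps of `P` after its last `N`-step. -/
def finalE (P : LatticePath) : ℕ := initialE P.reverse

/-- The path `E^k`. -/
def east (k : ℕ) : LatticePath := List.replicate k Step.E

/-- The map `φ` for `s = 2`. Write `P = E^a N E^b N T` and let `t` be the number of `E`-steps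
ending `T`.

* If `a + b + t ≥ r`, put `c = r - a - b`, so `P = E^a N E^b N Q E^c`, and
  `φ P = (E^a N E^b N E^c, Q)`.
* If `a + b + t < r`, put `c = t`, so `P = E^a N E^b N Q N E^c` with `Q = R E^(r+1)`, and
  `φ P = (E^a N E^(r-a-c) N E^c, E^(a+b+c+1) N R)`.

The second component is translated so that it starts at the origin. -/
def phi (r : ℕ) (P : LatticePath) : LatticePath × LatticePath :=
  let a := initialE P
  let S := P.drop (a + 1)
  let b := initialE S
  let T := S.drop (b + 1)
  let t := finalE T
  if r ≤ a + b + t then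
    let c := r - a - b
    let Q := T.rdrop c
    (east a ++ [Step.N] ++ east b ++ [Step.N] ++ east c, Q)
  else
    let c := t
    let R := (T.rdrop (c + 1)).rdrop (r + 1)
    (east a ++ [Step.N] ++ east (r - a - c) ++ [Step.N] ++ east c,
      east (a + b + c + 1) ++ [Step.N] ++ R)

/-- The map `Φ`, obtained from `φ` by applying it `n - 1` times, each time to the last
component: `Φ P = (P₁', …, P_n')`. -/
def Phi (r : ℕ) : (n : ℕ) → LatticePath → Fin n → LatticePath
  | 0, _ => Fin.elim0
  | 1, P => fun _ => P
  | n + 2, P => Fin.cons (phi r P).1 (Phi r (n + 1) (phi r P).2)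

end LatticePaths

/-! A path with `k` north steps is encoded by its run lengths `g 0, …, g k`. Write `X y = abscissa g
y` for the abscissa at which it arrives at height `y`. North steps enter the points `(X y, y)`, `y ≥
1`, and east steps enter row `y` exactly over the interval `(X y, X (y + 1)]`. Validity therefore
says that `X (y + 2 l) - l r` avoids that interval for all `l ≥ 1` (`valid_ofRuns_iff`).

The main consequence is propagation: if two consecutive rows advance by more than `r`, so do the two
rows starting one higher (`Separated.rise_succ`). Since the total advance is `n r`, this bounds
every abscissa: `X (2 i) ≤ i r`, and `X (2 i + 1) ≤ g 0 + i r` for `i < n`. In the second case of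
`φ` it also makes the last run but one longer than `r`, so that `E^(r+1)` can be removed.

In both cases of `φ`, the abscissas of the remaining path `q` are shifts of those of `g`, by two
rows or by one, so most validity inequalities carry over unchanged. The few that involve the removed
rows follow from the bounds (`isRuns_iff_of_le`, `isRuns_iff_of_lt`). With `φ P = (E^a N E^b N E^c,
q)`, the first case forces `q 0 ≤ a + c` and the second `q 0 > a + c`. The case can thus be read off
the image, which makes `φ` a bijection onto pairs (`phi_bijOn`). Iteration gives `Φ`, and `φ`
preserves the initial run, which gives the refined count. -/

namespace LatticePaths

/-! ### Run-length encoding of paths -/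

/-- The path `E^(g 0) N E^(g 1) N ⋯ N E^(g k)`. -/
def ofRuns (g : ℕ → ℕ) : ℕ → LatticePath
  | 0 => east (g 0)
  | k + 1 => ofRuns g k ++ Step.N :: east (g (k + 1))

/-- The abscissa of the `y`-th `N`-step of `ofRuns g k`. -/
def abscissa (g : ℕ → ℕ) (y : ℕ) : ℕ := ∑ i ∈ Finset.range y, g i

theorem abscissa_zero (g : ℕ → ℕ) : abscissa g 0 = 0 := rfl

theorem abscissa_succ (g : ℕ → ℕ) (y : ℕ) : abscissa g (y + 1) = abscissa g y + g y :=
  Finset.sum_range_succ g y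

theorem abscissa_mono (g : ℕ → ℕ) : Monotone (abscissa g) :=
  monotone_nat_of_le_succ fun y => by rw [abscissa_succ]; omega

theorem ofRuns_congr {g h : ℕ → ℕ} {k : ℕ} (H : ∀ i ≤ k, g i = h i) :
    ofRuns g k = ofRuns h k := by
  induction k with
  | zero => simp [ofRuns, H 0 le_rfl]
  | succ k ih => simp only [ofRuns, ih fun i hi => H i (by omega), H (k + 1) le_rfl]

theorem ofRuns_succ_eq_cons (g : ℕ → ℕ) (k : ℕ) :
    ofRuns g (k + 1) = east (g 0) ++ Step.N :: ofRuns (fun i => g (i + 1)) k := by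
  induction k with
  | zero => rfl
  | succ k ih =>
    rw [ofRuns, ih]
    simp [ofRuns]

theorem east_succ (m : ℕ) : east (m + 1) = east m ++ [Step.E] :=
  List.replicate_succ'

theorem exists_ofRuns (P : LatticePath) : ∃ g k, P = ofRuns g k := by
  induction P using List.reverseRecOn with
  | nil => exact ⟨fun _ => 0, 0, rfl⟩
  | append_singleton P s ih =>
    obtain ⟨g, k, rfl⟩ := ih
    cases s with
    | E =>
      refine ⟨Function.update g k (g k + 1), k, ?_⟩
      cases k with
      | zero => simp [ofRuns, east_succ]
      | succ k =>
        have : ofRuns (Function.update g (k + 1) (g (k + 1) + 1)) k = ofRuns g k :=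
          ofRuns_congr fun i hi => Function.update_of_ne (by omega) _ _
        simp [ofRuns, this, east_succ]
    | N =>
      refine ⟨Function.update g (k + 1) 0, k + 1, ?_⟩
      have : ofRuns (Function.update g (k + 1) 0) k = ofRuns g k :=
        ofRuns_congr fun i hi => Function.update_of_ne (by omega) _ _
      simp [ofRuns, this, east]

theorem initialE_east_append (m : ℕ) (P : LatticePath) :
    initialE (east m ++ Step.N :: P) = m := by
  simp [initialE, east]

theorem initialE_east (m : ℕ) : initialE (east m) = m := by
  simp [initialE, east]

theorem initialE_ofRuns (g : ℕ → ℕ) (k : ℕ) : initialE (ofRuns g k) = g 0 := by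
  cases k with
  | zero => exact initialE_east _
  | succ k => rw [ofRuns_succ_eq_cons, initialE_east_append]

theorem reverse_east (m : ℕ) : (east m).reverse = east m :=
  List.reverse_replicate

theorem finalE_ofRuns (g : ℕ → ℕ) (k : ℕ) : finalE (ofRuns g k) = g k := by
  cases k with
  | zero => rw [ofRuns, finalE, reverse_east, initialE_east]
  | succ k =>
    rw [ofRuns, finalE, List.reverse_append, List.reverse_cons, reverse_east, List.append_assoc]
    exact initialE_east_append _ _

theorem ofRuns_inj {g h : ℕ → ℕ} {k : ℕ} (H : ofRuns g k = ofRuns h k) :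
    ∀ i ≤ k, g i = h i := by
  induction k generalizing g h with
  | zero =>
    intro i hi
    obtain rfl : i = 0 := by omega
    simpa only [initialE_ofRuns] using congrArg initialE H
  | succ k ih =>
    have h0 : g 0 = h 0 := by simpa only [initialE_ofRuns] using congrArg initialE H
    rw [ofRuns_succ_eq_cons, ofRuns_succ_eq_cons, h0, List.append_cancel_left_eq] at H
    intro i hi
    cases i with
    | zero => exact h0
    | succ i => exact ih (List.cons.inj H).2 i (by omega)

theorem drop_ofRuns (g : ℕ → ℕ) (k : ℕ) :
    (ofRuns g (k + 1)).drop (g 0 + 1) = ofRuns (fun i => g (i + 1)) k := by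
  have : g 0 + 1 = (east (g 0) ++ [Step.N]).length := by simp [east]
  rw [ofRuns_succ_eq_cons, List.append_cons, this, List.drop_left]

theorem rdrop_append_length (P Q : LatticePath) : (P ++ Q).rdrop Q.length = P := by
  simp [List.rdrop]

theorem rdrop_ofRuns_succ (g : ℕ → ℕ) (k : ℕ) :
    (ofRuns g (k + 1)).rdrop (g (k + 1) + 1) = ofRuns g k := by
  have : g (k + 1) + 1 = (Step.N :: east (g (k + 1))).length := by simp [east]
  rw [this]
  exact rdrop_append_length _ _

theorem ofRuns_eq_append_east {g h : ℕ → ℕ} {k c : ℕ} (H : ∀ i < k, g i = h i)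
    (hk : g k = h k + c) : ofRuns g k = ofRuns h k ++ east c := by
  cases k with
  | zero => simp [ofRuns, east, hk]
  | succ k =>
    rw [ofRuns, ofRuns, ofRuns_congr (k := k) fun i hi => H i (by omega), hk]
    simp [east]

theorem rdrop_ofRuns {g h : ℕ → ℕ} {k c : ℕ} (H : ∀ i < k, g i = h i)
    (hk : g k = h k + c) : (ofRuns g k).rdrop c = ofRuns h k := by
  have : c = (east c).length := by simp [east]
  rw [ofRuns_eq_append_east H hk]
  conv_lhs => rw [this]
  simpa [east] using rdrop_append_length (ofRuns h k) (east c)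

/-! ### Endpoints and entered points -/

theorem LatticePath.endpoint_eq_sum (P : LatticePath) :
    P.endpoint = (P.map Step.vec).sum := by
  rw [LatticePath.endpoint, LatticePath.vertex, List.take_length]

theorem LatticePath.endpoint_append (P Q : LatticePath) :
    LatticePath.endpoint (P ++ Q) = P.endpoint + Q.endpoint := by
  simp only [LatticePath.endpoint_eq_sum, List.map_append, List.sum_append]

theorem LatticePath.vertex_concat_length (P : LatticePath) (s : Step) :
    LatticePath.vertex (P ++ [s]) (P.length + 1) = P.endpoint + s.vec := by
  rw [LatticePath.vertex, List.take_of_length_le (by simp), LatticePath.endpoint_eq_sum]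
  simp

theorem endpoint_east (m : ℕ) : (east m).endpoint = ((m : ℤ), 0) := by
  simp [LatticePath.vertex, LatticePath.endpoint, east, Step.vec]

theorem endpoint_ofRuns (g : ℕ → ℕ) (k : ℕ) :
    (ofRuns g k).endpoint = ((abscissa g (k + 1) : ℤ), (k : ℤ)) := by
  induction k with
  | zero => simp [ofRuns, endpoint_east, abscissa_succ, abscissa_zero]
  | succ k ih =>
    have : LatticePath.endpoint (Step.N :: east (g (k + 1))) = ((g (k + 1) : ℤ), 1) := by
      have := LatticePath.endpoint_append [Step.N] (east (g (k + 1)))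
      rw [endpoint_east] at this
      simpa [LatticePath.vertex, LatticePath.endpoint, Step.vec] using this
    rw [ofRuns, LatticePath.endpoint_append, ih, this, abscissa_succ g (k + 1)]
    simp

/-- `P` enters the point `v` with the step `x`. -/
def LatticePath.Enters (P : LatticePath) (v : ℤ × ℤ) (x : Step) : Prop :=
  ∃ i, P.EntersAt i v x

theorem LatticePath.enters_concat (P : LatticePath) (s : Step) (v : ℤ × ℤ) (x : Step) :
    LatticePath.Enters (P ++ [s]) v x ↔ P.Enters v x ∨ (v = P.endpoint + s.vec ∧ x = s) := by
  constructor
  · rintro ⟨i, hi, hv⟩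
    rcases lt_trichotomy i P.length with h | h | h
    · left
      refine ⟨i, ?_, ?_⟩
      · rwa [List.getElem?_append_left h] at hi
      · rw [← hv, LatticePath.vertex, LatticePath.vertex, List.take_append_of_le_length (by omega)]
    · right
      subst h
      refine ⟨?_, ?_⟩
      · rw [← hv, LatticePath.vertex_concat_length]
      · simpa using hi.symm
    · exfalso
      rw [List.getElem?_eq_none (by simp; omega)] at hi
      simp at hi
  · rintro (⟨i, hi, hv⟩ | ⟨rfl, rfl⟩)
    · have h : i < P.length := by
        by_contra h
        rw [List.getElem?_eq_none (by omega)] at hi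
        simp at hi
      refine ⟨i, ?_, ?_⟩
      · rwa [List.getElem?_append_left h]
      · rw [← hv, LatticePath.vertex, LatticePath.vertex, List.take_append_of_le_length (by omega)]
    · exact ⟨P.length, by simp, LatticePath.vertex_concat_length P x⟩

/-- Every step raises `x + y` by one. Hence the order of two entries along the path is determined by
their coordinates, and a later equivalent point is a translate by a positive multiple of `(r, s)`.
-/
theorem LatticePath.EntersAt.add_eq {P : LatticePath} {i : ℕ} {v : ℤ × ℤ} {x : Step}
    (h : P.EntersAt i v x) : v.1 + v.2 = i + 1 := by
  obtain ⟨hi, rfl⟩ := h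
  have hlt : i < P.length := (List.getElem?_eq_some_iff.1 hi).1
  have key : ∀ L : LatticePath, (L.map Step.vec).sum.1 + (L.map Step.vec).sum.2 = L.length := by
    intro L
    induction L with
    | nil => simp
    | cons s L ih =>
      cases s <;> simp [Step.vec] <;> linarith
  rw [LatticePath.vertex, key, List.length_take, min_eq_left (by omega)]
  simp

theorem enters_append_east (P : LatticePath) (m : ℕ) (v : ℤ × ℤ) (x : Step) :
    LatticePath.Enters (P ++ east m) v x ↔ P.Enters v x ∨
      (x = Step.E ∧ v.2 = P.endpoint.2 ∧ P.endpoint.1 < v.1 ∧ v.1 ≤ P.endpoint.1 + m) := by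
  induction m with
  | zero =>
    simp only [east, List.replicate_zero, List.append_nil]
    constructor
    · exact Or.inl
    · rintro (h | ⟨-, -, h1, h2⟩)
      · exact h
      · push_cast at h2
        omega
  | succ m ih =>
    rw [east_succ, ← List.append_assoc, LatticePath.enters_concat, ih,
      LatticePath.endpoint_append, endpoint_east]
    obtain ⟨p, q⟩ := v
    simp only [Step.vec, Prod.ext_iff, Prod.fst_add, Prod.snd_add]
    push_cast
    constructor
    · rintro ((h | ⟨h, h1, h2, h3⟩) | ⟨⟨h1, h2⟩, h3⟩)
      · exact Or.inl h
      · exact Or.inr ⟨h, h1, h2, by omega⟩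
      · exact Or.inr ⟨h3, by omega, by omega, by omega⟩
    · rintro (h | ⟨h, h1, h2, h3⟩)
      · exact Or.inl (Or.inl h)
      · by_cases h4 : p ≤ P.endpoint.1 + m
        · exact Or.inl (Or.inr ⟨h, h1, h2, h4⟩)
        · exact Or.inr ⟨⟨by omega, by omega⟩, h⟩

theorem enters_ofRuns (g : ℕ → ℕ) (k : ℕ) (v : ℤ × ℤ) (x : Step) :
    (ofRuns g k).Enters v x ↔
      (x = Step.E ∧ ∃ y ≤ k, v.2 = (y : ℤ) ∧ (abscissa g y : ℤ) < v.1 ∧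
        v.1 ≤ (abscissa g (y + 1) : ℤ)) ∨
      (x = Step.N ∧ ∃ y < k, v.2 = (y : ℤ) + 1 ∧ v.1 = (abscissa g (y + 1) : ℤ)) := by
  induction k with
  | zero =>
    have h0 : ¬ LatticePath.Enters [] v x := by
      rintro ⟨i, hi, -⟩
      simp at hi
    have := enters_append_east [] (g 0) v x
    simp only [List.nil_append, h0, false_or] at this
    rw [ofRuns, this]
    simp [LatticePath.endpoint, LatticePath.vertex, abscissa_succ, abscissa_zero]
  | succ k ih =>
    rw [ofRuns, List.append_cons, enters_append_east, LatticePath.enters_concat, ih,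
      LatticePath.endpoint_append, endpoint_ofRuns]
    obtain ⟨p, q⟩ := v
    have hN : LatticePath.endpoint [Step.N] = (0, 1) := by
      simp [LatticePath.endpoint, LatticePath.vertex, Step.vec]
    rw [hN]
    simp only [Step.vec, Prod.mk_add_mk, Prod.mk.injEq, add_zero]
    constructor
    · rintro (((⟨h, y, h1, h2⟩ | ⟨h, y, h1, h2⟩) | ⟨h, h1⟩) | ⟨h, h1, h2, h3⟩)
      · exact Or.inl ⟨h, y, by omega, h2⟩
      · exact Or.inr ⟨h, y, by omega, h2⟩
      · exact Or.inr ⟨h1, k, by omega, h.2, h.1⟩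
      · refine Or.inl ⟨h, k + 1, le_rfl, by exact_mod_cast h1, h2, ?_⟩
        rw [abscissa_succ g (k + 1)]
        exact_mod_cast h3
    · rintro (⟨h, y, h1, h2, h3, h4⟩ | ⟨h, y, h1, h2⟩)
      · rcases Nat.lt_or_ge k y with hy | hy
        · obtain rfl : y = k + 1 := by omega
          rw [abscissa_succ g (k + 1)] at h4
          exact Or.inr ⟨h, by exact_mod_cast h2, h3, by exact_mod_cast h4⟩
        · exact Or.inl (Or.inl (Or.inl ⟨h, y, hy, h2, h3, h4⟩))
      · rcases Nat.lt_or_ge y k with hy | hy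
        · exact Or.inl (Or.inl (Or.inr ⟨h, y, hy, h2⟩))
        · obtain rfl : y = k := by omega
          exact Or.inl (Or.inr ⟨⟨h2.2, h2.1⟩, h⟩)

/-! ### Validity as inequalities between abscissas -/

/-- A violation is a point entered by a north step at height `y + 2 * l` whose translate by `-l (r,
2)` lies among the points of row `y` entered by east steps. The two alternatives place that
translate to the left or to the right of those points. -/
theorem valid_ofRuns_iff (r k : ℕ) (g : ℕ → ℕ) :
    (ofRuns g k).Valid r 2 ↔ ∀ y l, 1 ≤ l → y + 2 * l ≤ k →
      abscissa g (y + 2 * l) ≤ abscissa g y + l * r ∨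
        abscissa g (y + 1) + l * r < abscissa g (y + 2 * l) := by
  constructor
  · intro H y l hl hy
    by_contra! hcon
    obtain ⟨h1, h2⟩ := hcon
    have hN : (ofRuns g k).Enters
        ((abscissa g (y + 2 * l) : ℤ), ((y + 2 * l : ℕ) : ℤ)) Step.N := by
      rw [enters_ofRuns]
      refine Or.inr ⟨rfl, y + 2 * l - 1, by omega, ?_, ?_⟩
      · simp only; omega
      · rw [Nat.sub_add_cancel (by omega)]
    have hE : (ofRuns g k).Enters
        ((abscissa g (y + 2 * l) : ℤ) - l * r, (y : ℤ)) Step.E := by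
      rw [enters_ofRuns]
      refine Or.inl ⟨rfl, y, by omega, rfl, ?_, ?_⟩
      · simp only; zify at h1; linarith
      · simp only; zify at h2; linarith
    obtain ⟨i, hi⟩ := hE
    obtain ⟨j, hj⟩ := hN
    have hij : i < j := by
      have h3 := hi.add_eq
      have h4 := hj.add_eq
      have : (0 : ℤ) ≤ l * r := by positivity
      push_cast at h3 h4
      zify at hl ⊢
      linarith
    have := H i j _ _ _ hij hi hj ⟨l, by ext <;> simp; ring⟩
    simp at this
  · intro H i j v w x hij hi hj hvw
    cases x with
    | E => rfl
    | N =>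
      exfalso
      have hi' := (enters_ofRuns g k v _).1 ⟨i, hi⟩
      have hj' := (enters_ofRuns g k w _).1 ⟨j, hj⟩
      simp only [true_and, reduceCtorEq, false_and, or_false, false_or] at hi' hj'
      obtain ⟨y, hy, hy1, hy2, hy3⟩ := hi'
      obtain ⟨z, hz, hz1, hz2⟩ := hj'
      obtain ⟨l, hl⟩ := hvw
      have e1 : w.1 - v.1 = l * r := by simpa using congrArg Prod.fst hl
      have e2 : w.2 - v.2 = l * 2 := by simpa using congrArg Prod.snd hl
      have hsum : v.1 + v.2 < w.1 + w.2 := by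
        rw [hi.add_eq, hj.add_eq]; exact_mod_cast Nat.add_lt_add_right hij 1
      have hl0 : 0 < l := by
        by_contra hl0
        have : l * (r : ℤ) ≤ 0 := mul_nonpos_of_nonpos_of_nonneg (by omega) (by positivity)
        linarith
      lift l to ℕ using hl0.le
      have hzy : z + 1 = y + 2 * l := by omega
      have := H y l (by omega) (by omega)
      rw [← hzy] at this
      zify at this
      rcases this with h | h <;> linarith

/-- The condition on run lengths which expresses validity for `s = 2`. -/
def Separated (r k : ℕ) (g : ℕ → ℕ) : Prop :=
  ∀ y l, 1 ≤ l → y + 2 * l ≤ k →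
    abscissa g (y + 2 * l) ≤ abscissa g y + l * r ∨
      abscissa g (y + 1) + l * r < abscissa g (y + 2 * l)

/-- The run lengths of the paths in `validPaths r 2 n`. -/
def IsRuns (r n : ℕ) (g : ℕ → ℕ) : Prop :=
  abscissa g (2 * n + 1) = n * r ∧ Separated r (2 * n) g

/-! ### Propagation of large rises and bounds on abscissas -/

theorem abscissa_one (g : ℕ → ℕ) : abscissa g 1 = g 0 := by
  rw [abscissa_succ, abscissa_zero, zero_add]

theorem abscissa_two (g : ℕ → ℕ) : abscissa g 2 = g 0 + g 1 := by
  rw [abscissa_succ, abscissa_one]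

/-- The hypothesis excludes the first alternative of `Separated` at `l = 1`. The second gives the
conclusion with `y + 2` in place of `y + 3` on the right, and `abscissa` is monotone. -/
theorem Separated.rise_succ {r k y : ℕ} {g : ℕ → ℕ} (H : Separated r k g) (hy : y + 3 ≤ k)
    (h : abscissa g y + r < abscissa g (y + 2)) :
    abscissa g (y + 1) + r < abscissa g (y + 3) := by
  have h1 := H y 1 le_rfl (by omega)
  have h2 := abscissa_mono g (show y + 2 ≤ y + 3 by omega)
  simp only [mul_one, one_mul] at h1
  omega

theorem Separated.rise_lt {r k y : ℕ} {g : ℕ → ℕ} (H : Separated r k g) (l : ℕ)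
    (hy : y + 2 * (l + 1) ≤ k) (h : abscissa g y + r < abscissa g (y + 2)) :
    abscissa g y + (l + 1) * r < abscissa g (y + 2 * (l + 1)) := by
  induction l generalizing y with
  | zero => simpa using h
  | succ l ih =>
    have h1 := H.rise_succ (y := y + 1) (by omega) (H.rise_succ (by omega) h)
    have h2 := ih (y := y + 2) (by omega) h1
    rw [show y + 2 * (l + 1 + 1) = y + 2 + 2 * (l + 1) by ring, add_mul (l + 1), one_mul]
    omega

theorem IsRuns.last {r n : ℕ} {g : ℕ → ℕ} (H : IsRuns r n g) :
    abscissa g (2 * n) + g (2 * n) = n * r := by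
  rw [← abscissa_succ, H.1]

/-- Induction from the left works while two rows advance by at most `r`. If they advance by more,
all later pairs do as well, and the bound follows by comparison with the end of the path. -/
theorem IsRuns.abscissa_even_le {r n : ℕ} {g : ℕ → ℕ} (H : IsRuns r n g) {i : ℕ} (hi : i ≤ n) :
    abscissa g (2 * i) ≤ i * r := by
  induction i with
  | zero => simp [abscissa_zero]
  | succ i ih =>
    have h1 := ih (by omega)
    by_cases h : abscissa g (2 * i) + r < abscissa g (2 * i + 2)
    · have hlast := H.last
      obtain ⟨d, rfl⟩ := Nat.exists_eq_add_of_le hi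
      cases d with
      | zero => simp only [add_zero] at hlast; omega
      | succ d =>
        have h2 := H.2.rise_succ (y := 2 * i + 1) (by omega) (H.2.rise_succ (by omega) h)
        have h3 := H.2.rise_lt d (by omega) h2
        rw [show 2 * i + 1 + 1 + 2 * (d + 1) = 2 * (i + 1 + (d + 1)) by ring] at h3
        rw [add_mul (i + 1)] at hlast
        rw [show 2 * (i + 1) = 2 * i + 1 + 1 by ring]
        omega
    · rw [add_mul, one_mul, show 2 * (i + 1) = 2 * i + 2 by ring]
      omega

/-- When the advance exceeds `r`, propagation excludes the first alternative of `Separated` at row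
`2 * i + 2`. The row therefore ends more than `r` before `abscissa g (2 * i + 4)`, which is at most
`(i + 2) * r`. -/
theorem IsRuns.abscissa_odd_le {r n : ℕ} {g : ℕ → ℕ} (H : IsRuns r n g) {i : ℕ} (hi : i < n) :
    abscissa g (2 * i + 1) ≤ g 0 + i * r := by
  induction i with
  | zero => simp [abscissa_one]
  | succ i ih =>
    have h1 := ih (by omega)
    by_cases h : abscissa g (2 * i + 1) + r < abscissa g (2 * i + 1 + 2)
    · have h2 := H.2.rise_succ (by omega) h
      have h3 := H.2 (2 * i + 2) 1 le_rfl (by omega)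
      have h4 := H.abscissa_even_le (i := i + 1 + 1) (by omega)
      rw [add_mul (i + 1), one_mul, show 2 * (i + 1 + 1) = 2 * i + 4 by ring] at h4
      rw [mul_one, one_mul, show 2 * i + 2 + 1 = 2 * i + 3 by ring,
        show 2 * i + 2 + 2 = 2 * i + 4 by ring] at h3
      rw [show 2 * i + 1 + 1 = 2 * i + 2 by ring, show 2 * i + 1 + 3 = 2 * i + 4 by ring] at h2
      rw [show 2 * (i + 1) + 1 = 2 * i + 3 by ring]
      omega
    · rw [add_mul, one_mul, show 2 * (i + 1) + 1 = 2 * i + 1 + 2 by ring]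
      omega

/-- The hypothesis `h` is the condition for the second case of `φ`. The inequality is first shown at
the left end of row `2 * (j + 1)`; `Separated` then carries it to the right end. For `d = 1` it says
that the last run but one exceeds `r`. -/
theorem IsRuns.abscissa_odd_lt {r m : ℕ} {g : ℕ → ℕ} (H : IsRuns r (m + 1) g)
    (h : abscissa g 2 + m * r < abscissa g (2 * (m + 1))) {j d : ℕ} (hd : 1 ≤ d)
    (hjd : j + d = m) :
    abscissa g (2 * (j + 1) + 1) + d * r < abscissa g (2 * (m + 1)) := by
  have key : abscissa g (2 * (j + 1)) + d * r < abscissa g (2 * (m + 1)) := by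
    induction j generalizing d with
    | zero =>
      obtain rfl : d = m := by omega
      simpa using h
    | succ j ih =>
      have h1 := ih (d := d + 1) (by omega) (by omega)
      rw [add_mul, one_mul] at h1
      by_cases h2 : abscissa g (2 * (j + 1)) + r < abscissa g (2 * (j + 1) + 2)
      · have h3 := H.2.rise_succ (y := 2 * (j + 1) + 1) (by omega)
          (H.2.rise_succ (by omega) h2)
        obtain ⟨e, rfl⟩ := Nat.exists_eq_add_of_le' hd
        have h4 := H.2.rise_lt e (by omega) h3
        rw [show 2 * (j + 1) + 1 + 1 + 2 * (e + 1) = 2 * (m + 1) by omega] at h4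
        exact h4
      · rw [show 2 * (j + 1 + 1) = 2 * (j + 1) + 2 by ring]
        omega
  have h1 := H.2 (2 * (j + 1)) d hd (by omega)
  rw [show 2 * (j + 1) + 2 * d = 2 * (m + 1) by omega] at h1
  omega

/-- The hypothesis `h` is the condition for the first case of `φ`; the conclusion becomes `q 0 ≤ a +
c`. A larger rise at row 1 would propagate from row 2 to the last north step and contradict `h`. -/
theorem IsRuns.abscissa_three_le {r m : ℕ} {g : ℕ → ℕ} (hm : 1 ≤ m) (H : IsRuns r (m + 1) g)
    (h : abscissa g (2 * (m + 1)) ≤ abscissa g 2 + m * r) :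
    abscissa g 3 ≤ abscissa g 1 + r := by
  by_contra! h1
  have h2 := H.2.rise_succ (y := 1) (by omega) h1
  obtain ⟨e, rfl⟩ := Nat.exists_eq_add_of_le' hm
  have h3 := H.2.rise_lt (y := 2) e (by omega) h2
  rw [show 2 + 2 * (e + 1) = 2 * (e + 1 + 1) by ring] at h3
  omega

theorem ofRuns_mem_validPaths {r n : ℕ} {g : ℕ → ℕ} :
    ofRuns g (2 * n) ∈ validPaths r 2 n ↔ IsRuns r n g := by
  rw [validPaths, Set.mem_ofPred_eq, endpoint_ofRuns, valid_ofRuns_iff, IsRuns, Separated,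
    Prod.mk.injEq]
  refine and_congr_left fun _ => ?_
  push_cast
  constructor
  · rintro ⟨h, -⟩
    exact_mod_cast h
  · intro h
    exact ⟨by exact_mod_cast h, by ring⟩

theorem mem_validPaths_iff {r n : ℕ} {P : LatticePath} :
    P ∈ validPaths r 2 n ↔ ∃ g, IsRuns r n g ∧ P = ofRuns g (2 * n) := by
  constructor
  · intro hP
    obtain ⟨g, k, rfl⟩ := exists_ofRuns P
    have h := congrArg Prod.snd hP.1
    rw [endpoint_ofRuns] at h
    simp only at h
    obtain rfl : k = 2 * n := by push_cast at h; omega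
    exact ⟨g, ofRuns_mem_validPaths.1 hP, rfl⟩
  · rintro ⟨g, hg, rfl⟩
    exact ofRuns_mem_validPaths.2 hg

/-! ### Paths with two north steps -/

/-- The path `E^a N E^b N E^c`. -/
def tri (a b c : ℕ) : LatticePath := east a ++ [Step.N] ++ east b ++ [Step.N] ++ east c

theorem ofRuns_two (g : ℕ → ℕ) : ofRuns g 2 = tri (g 0) (g 1) (g 2) := by
  simp [ofRuns, tri]

theorem tri_eq_ofRuns (a b c : ℕ) :
    tri a b c = ofRuns (fun i => if i = 0 then a else if i = 1 then b else c) 2 := by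
  simp [ofRuns_two]

theorem initialE_tri (a b c : ℕ) : initialE (tri a b c) = a := by
  rw [tri_eq_ofRuns, initialE_ofRuns, if_pos rfl]

theorem tri_inj {a b c a' b' c' : ℕ} (h : tri a b c = tri a' b' c') :
    a = a' ∧ b = b' ∧ c = c' := by
  rw [tri_eq_ofRuns, tri_eq_ofRuns] at h
  have := ofRuns_inj h
  exact ⟨by simpa using this 0 (by omega), by simpa using this 1 (by omega),
    by simpa using this 2 (by omega)⟩

theorem isRuns_one_iff {r : ℕ} {g : ℕ → ℕ} : IsRuns r 1 g ↔ g 0 + g 1 + g 2 = r := by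
  have h3 : abscissa g (2 * 1 + 1) = g 0 + g 1 + g 2 := by
    rw [abscissa_succ, mul_one, abscissa_two]
  rw [IsRuns, h3, one_mul]
  refine and_iff_left_of_imp fun h y l hl hy => Or.inl ?_
  obtain rfl : l = 1 := by omega
  obtain rfl : y = 0 := by omega
  simp only [zero_add, mul_one, abscissa_two, one_mul]
  omega

theorem mem_validPaths_one_iff {r : ℕ} {P : LatticePath} :
    P ∈ validPaths r 2 1 ↔ ∃ a b c, a + b + c = r ∧ P = tri a b c := by
  rw [mem_validPaths_iff]
  constructor
  · rintro ⟨g, hg, rfl⟩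
    exact ⟨g 0, g 1, g 2, isRuns_one_iff.1 hg, ofRuns_two g⟩
  · rintro ⟨a, b, c, h, rfl⟩
    exact ⟨_, isRuns_one_iff.2 (by simpa using h), tri_eq_ofRuns a b c⟩

/-! ### The map `φ` on run lengths -/

theorem phi_ofRuns_of_le {r k a b c : ℕ} {g q : ℕ → ℕ} (h0 : g 0 = a) (h1 : g 1 = b)
    (habc : a + b + c = r) (hq : ∀ i < k, g (i + 2) = q i) (hk : g (k + 2) = q k + c) :
    phi r (ofRuns g (k + 2)) = (tri a b c, ofRuns q k) := by
  have hb : initialE (ofRuns (fun i => g (i + 1)) (k + 1)) = g 1 := initialE_ofRuns _ _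
  have hT : (ofRuns (fun i => g (i + 1)) (k + 1)).drop (g 1 + 1) =
    ofRuns (fun i => g (i + 2)) k := drop_ofRuns (fun i => g (i + 1)) k
  rw [phi]
  simp only [initialE_ofRuns, drop_ofRuns, zero_add]
  rw [hT, finalE_ofRuns, if_pos (by omega), rdrop_ofRuns (h := q) hq (by omega), h0, h1,
    show r - a - b = c by omega, tri]

theorem phi_ofRuns_of_lt {r k a b c : ℕ} {g q : ℕ → ℕ} (h0 : g 0 = a)
    (hq0 : q 0 = a + g 1 + c + 1) (habc : a + b + c = r) (hlt : g 1 < b)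
    (hq : ∀ i < k, g (i + 2) = q (i + 1)) (hk : g (k + 2) = q (k + 1) + (r + 1))
    (hk1 : g (k + 3) = c) :
    phi r (ofRuns g (k + 3)) = (tri a b c, ofRuns q (k + 1)) := by
  have hT : (ofRuns (fun i => g (i + 1)) (k + 2)).drop (g 1 + 1) =
    ofRuns (fun i => g (i + 2)) (k + 1) := drop_ofRuns (fun i => g (i + 1)) (k + 1)
  have hR : (ofRuns (fun i => g (i + 2)) (k + 1)).rdrop (c + 1) =
      ofRuns (fun i => g (i + 2)) k := by
    rw [← hk1]
    exact rdrop_ofRuns_succ (fun i => g (i + 2)) k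
  rw [phi]
  simp only [initialE_ofRuns, drop_ofRuns, zero_add]
  rw [hT, finalE_ofRuns]
  simp only [show k + 1 + 2 = k + 3 from rfl, hk1, h0]
  rw [if_neg (by omega), hR, rdrop_ofRuns (h := fun i => q (i + 1)) hq hk,
    show r - a - c = b by omega, tri, ofRuns_succ_eq_cons q, hq0]
  simp

theorem abscissa_add_two_of_le {k a b : ℕ} {g q : ℕ → ℕ} (h0 : g 0 = a) (h1 : g 1 = b)
    (hq : ∀ i < k, g (i + 2) = q i) {y : ℕ} (hy : y ≤ k) :
    abscissa g (y + 2) = a + b + abscissa q y := by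
  induction y with
  | zero => rw [zero_add, abscissa_two, abscissa_zero, h0, h1, add_zero]
  | succ y ih =>
    rw [show y + 1 + 2 = y + 2 + 1 by ring, abscissa_succ, ih (by omega), abscissa_succ,
      hq y (by omega)]
    ring

theorem abscissa_add_one_of_lt {k a c : ℕ} {g q : ℕ → ℕ} (h0 : g 0 = a)
    (hq0 : q 0 = a + g 1 + c + 1) (hq : ∀ i < k, g (i + 2) = q (i + 1)) {y : ℕ} (hy : y ≤ k) :
    abscissa g (y + 2) + (c + 1) = abscissa q (y + 1) := by
  induction y with
  | zero => rw [zero_add, abscissa_two, abscissa_one, hq0]; omega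
  | succ y ih =>
    rw [show y + 1 + 2 = y + 2 + 1 by ring, abscissa_succ, abscissa_succ q, ← ih (by omega),
      hq y (by omega)]
    ring

/-- Rows from 2 on are translates of the rows of `q`, so only rows 0 and 1 of `g` impose new
conditions. Row 0 is harmless by the even bound for `q`; row 1 is where `q 0 ≤ a + c` enters. -/
theorem isRuns_iff_of_le {r m a b c : ℕ} {g q : ℕ → ℕ} (hm : 1 ≤ m) (h0 : g 0 = a)
    (h1 : g 1 = b) (habc : a + b + c = r) (hq : ∀ i < 2 * m, g (i + 2) = q i)
    (hk : g (2 * m + 2) = q (2 * m) + c) :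
    IsRuns r (m + 1) g ↔ IsRuns r m q ∧ q 0 ≤ a + c := by
  have hX : ∀ y ≤ 2 * m, abscissa g (y + 2) = a + b + abscissa q y := fun y hy =>
    abscissa_add_two_of_le h0 h1 hq hy
  have hend : abscissa g (2 * (m + 1) + 1) = abscissa q (2 * m + 1) + r := by
    rw [abscissa_succ, abscissa_succ, show 2 * (m + 1) = 2 * m + 2 by ring, hX _ le_rfl, hk]
    omega
  constructor
  · intro H
    have hr : abscissa q (2 * m + 1) = m * r := by
      have := H.1
      rw [hend, add_mul] at this
      omega
    refine ⟨⟨hr, fun y l hl hy => ?_⟩, ?_⟩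
    · have := H.2 (y + 2) l hl (by omega)
      rw [show y + 2 + 2 * l = y + 2 * l + 2 by ring, show y + 2 + 1 = y + 1 + 2 by ring,
        hX _ hy, hX _ (by omega), hX _ (by omega)] at this
      omega
    · have h2 := hX (2 * m) le_rfl
      have h3 := abscissa_succ q (2 * m)
      have h4 := H.abscissa_three_le hm (by
        rw [show 2 * (m + 1) = 2 * m + 2 by ring, abscissa_two]
        omega)
      have h5 := hX 1 (by omega)
      rw [abscissa_one] at h4 h5
      rw [show 1 + 2 = 3 from rfl] at h5
      omega
  · rintro ⟨H, ha⟩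
    refine ⟨by rw [hend, H.1, add_mul, one_mul], fun y l hl hy => ?_⟩
    obtain ⟨j, rfl⟩ := Nat.exists_eq_add_of_le' hl
    match y with
    | 0 =>
      have h2 := H.abscissa_even_le (i := j) (by omega)
      rw [show 0 + 2 * (j + 1) = 2 * j + 2 by ring, hX _ (by omega), abscissa_zero, add_mul]
      omega
    | 1 =>
      have h2 := H.abscissa_odd_le (i := j) (by omega)
      rw [show 1 + 2 * (j + 1) = 2 * j + 1 + 2 by ring, hX _ (by omega), abscissa_one, add_mul]
      omega
    | y + 2 =>
      have := H.2 y (j + 1) hl (by omega)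
      rw [show y + 2 + 2 * (j + 1) = y + 2 * (j + 1) + 2 by ring,
        show y + 2 + 1 = y + 1 + 2 by ring, hX _ (by omega), hX _ (by omega), hX _ (by omega)]
      omega

/-- Here `q` lags behind `g` by one row only, with horizontal shift `c + 1`. Conditions not
inherited are those on row 0 of `q`, on rows 0 and 1 of `g`, and on the last north step of `g`. -/
theorem isRuns_iff_of_lt {r k m a b c : ℕ} {g q : ℕ → ℕ} (hm : k + 1 = 2 * m) (h0 : g 0 = a)
    (hq0 : q 0 = a + g 1 + c + 1) (habc : a + b + c = r) (hlt : g 1 < b)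
    (hq : ∀ i < k, g (i + 2) = q (i + 1)) (hk : g (k + 2) = q (k + 1) + (r + 1))
    (hk1 : g (k + 3) = c) :
    IsRuns r (m + 1) g ↔ IsRuns r m q := by
  have hX : ∀ y ≤ k, abscissa g (y + 2) + (c + 1) = abscissa q (y + 1) := fun y hy =>
    abscissa_add_one_of_lt h0 hq0 hq hy
  have hlast : abscissa g (k + 3) = abscissa q (k + 2) + r - c := by
    have := hX k le_rfl
    rw [abscissa_succ g (k + 2), abscissa_succ q (k + 1), hk]
    omega
  have hend : abscissa g (2 * (m + 1) + 1) = abscissa q (2 * m + 1) + r := by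
    have := hX k le_rfl
    have h2 := abscissa_succ q (k + 1)
    rw [abscissa_succ, ← hm, show 2 * (m + 1) = k + 3 by omega, hlast, hk1]
    rw [show k + 1 + 1 = k + 2 from rfl] at *
    omega
  have hmul : (m + 1) * r = m * r + r := by rw [add_mul, one_mul]
  constructor
  · intro H
    have hr : abscissa q (2 * m + 1) = m * r := by
      have := H.1
      omega
    have hr' : abscissa q (k + 2) = m * r := by rw [← hr, ← hm]
    refine ⟨hr, fun y l hl hy => ?_⟩
    obtain ⟨j, rfl⟩ := Nat.exists_eq_add_of_le' hl
    cases y with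
    | zero =>
      -- Row 0 of `q` starts at 0, which is not the shift of an abscissa of `g`. The first
      -- alternative is obtained from `IsRuns.abscissa_odd_lt`.
      obtain ⟨d, hd⟩ := Nat.exists_eq_add_of_le (show j + 1 ≤ m by omega)
      have h2 := H.abscissa_odd_lt (j := j) (d := d + 1) (by
        rw [show 2 * (m + 1) = k + 3 by omega, hlast, abscissa_two, hr']
        omega) (by omega) (by omega)
      have h3 := hX (2 * j + 1) (by omega)
      rw [show 2 * (m + 1) = k + 3 by omega, hlast, hr',
        show 2 * (j + 1) + 1 = 2 * j + 3 by ring, add_mul d, one_mul] at h2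
      rw [show 2 * j + 1 + 2 = 2 * j + 3 by ring, show 2 * j + 1 + 1 = 2 * (j + 1) by ring] at h3
      have h4 : m * r = (j + 1) * r + d * r := by rw [hd, add_mul]
      rw [zero_add, abscissa_zero]
      omega
    | succ y =>
      have h2 := H.2 (y + 2) (j + 1) hl (by omega)
      have h3 := hX (y + 2 * (j + 1)) (by omega)
      have h4 := hX y (by omega)
      have h5 := hX (y + 1) (by omega)
      rw [show y + 2 + 2 * (j + 1) = y + 2 * (j + 1) + 2 by ring] at h2
      rw [show y + 1 + 2 * (j + 1) = y + 2 * (j + 1) + 1 by ring]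
      rw [show y + 1 + 2 = y + 2 + 1 from rfl] at h5
      omega
  · intro H
    have hr' : abscissa q (k + 2) = m * r := by rw [← H.1, ← hm]
    refine ⟨by rw [hend, H.1, add_mul, one_mul], fun y l hl hy => ?_⟩
    obtain ⟨j, rfl⟩ := Nat.exists_eq_add_of_le' hl
    have hj : (j + 1) * r = j * r + r := by rw [add_mul, one_mul]
    rcases Nat.lt_or_ge (y + 2 * (j + 1)) (k + 3) with hlt' | hge
    · match y with
      | 0 =>
        have h1 := hX (2 * j) (by omega)
        have h2 := H.abscissa_odd_le (i := j) (by omega)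
        have h3 := H.abscissa_even_le (i := 1) (by omega)
        have h4 := abscissa_mono q (show 1 ≤ 2 * 1 by omega)
        rw [abscissa_one] at h4
        rw [show 0 + 2 * (j + 1) = 2 * j + 2 by ring, abscissa_zero]
        omega
      | 1 =>
        have h1 := hX (2 * j + 1) (by omega)
        have h2 := H.abscissa_even_le (i := j + 1) (by omega)
        rw [show 2 * j + 1 + 1 = 2 * (j + 1) by ring] at h1
        rw [show 1 + 2 * (j + 1) = 2 * j + 1 + 2 by ring, abscissa_one]
        omega
      | y + 2 =>
        have h1 := H.2 (y + 1) (j + 1) hl (by omega)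
        have h2 := hX (y + 2 * (j + 1)) (by omega)
        have h3 := hX y (by omega)
        have h4 := hX (y + 1) (by omega)
        rw [show y + 1 + 2 * (j + 1) = y + 2 * (j + 1) + 1 by ring] at h1
        rw [show y + 2 + 2 * (j + 1) = y + 2 * (j + 1) + 2 by ring]
        rw [show y + 1 + 2 = y + 2 + 1 from rfl] at h4
        omega
    -- The remaining index is the last north step, to which the shift formula does not apply. It
    -- lies at abscissa `(m + 1) * r - c`: its translate is not to the right of the start of row 0,
    -- and it lies strictly to the right of every other even row below it.
    · obtain ⟨i, rfl⟩ : ∃ i, y = 2 * i := ⟨y / 2, by omega⟩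
      obtain rfl : m = i + j := by omega
      rw [show 2 * i + 2 * (j + 1) = k + 3 by omega, hlast, hr']
      have hij : (i + j) * r = i * r + j * r := add_mul _ _ _
      cases i with
      | zero =>
        left
        rw [mul_zero, abscissa_zero]
        omega
      | succ i =>
        right
        have h1 := hX (2 * i + 1) (by omega)
        have h2 := H.abscissa_even_le (i := i + 1) (by omega)
        rw [show 2 * i + 1 + 1 = 2 * (i + 1) by ring] at h1
        rw [show 2 * (i + 1) + 1 = 2 * i + 1 + 2 by ring]
        omega

/-- The first case of `φ` in terms of run lengths: `φ` maps `ofRuns g (2 * m + 2)` to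
`(tri a b c, ofRuns q (2 * m))`. -/
def DecompLe (r m a b c : ℕ) (g q : ℕ → ℕ) : Prop :=
  g 0 = a ∧ g 1 = b ∧ a + b + c = r ∧ (∀ i < 2 * m, g (i + 2) = q i) ∧
    g (2 * m + 2) = q (2 * m) + c

/-- The second case of `φ` in terms of run lengths: `φ` maps `ofRuns g (2 * m + 2)` to
`(tri a b c, ofRuns q (2 * m))`. -/
def DecompLt (r m a b c : ℕ) (g q : ℕ → ℕ) : Prop :=
  g 0 = a ∧ q 0 = a + g 1 + c + 1 ∧ a + b + c = r ∧ g 1 < b ∧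
    (∀ i < 2 * m - 1, g (i + 2) = q (i + 1)) ∧ g (2 * m + 1) = q (2 * m) + (r + 1) ∧
    g (2 * m + 2) = c

theorem DecompLe.phi_eq {r m a b c : ℕ} {g q : ℕ → ℕ} (h : DecompLe r m a b c g q) :
    phi r (ofRuns g (2 * (m + 1))) = (tri a b c, ofRuns q (2 * m)) :=
  phi_ofRuns_of_le h.1 h.2.1 h.2.2.1 h.2.2.2.1 h.2.2.2.2

theorem DecompLt.phi_eq {r m a b c : ℕ} {g q : ℕ → ℕ} (hm : 1 ≤ m)
    (h : DecompLt r m a b c g q) :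
    phi r (ofRuns g (2 * (m + 1))) = (tri a b c, ofRuns q (2 * m)) := by
  obtain ⟨h1, h2, h3, h4, h5, h6, h7⟩ := h
  obtain ⟨k, hk⟩ : ∃ k, k + 1 = 2 * m := ⟨2 * m - 1, by omega⟩
  rw [← hk] at h5 h6 h7 ⊢
  rw [show 2 * (m + 1) = k + 3 by omega]
  exact phi_ofRuns_of_lt h1 h2 h3 h4 h5 h6 h7

theorem DecompLt.isRuns_iff {r m a b c : ℕ} {g q : ℕ → ℕ} (hm : 1 ≤ m)
    (h : DecompLt r m a b c g q) : IsRuns r (m + 1) g ↔ IsRuns r m q := by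
  obtain ⟨h1, h2, h3, h4, h5, h6, h7⟩ := h
  obtain ⟨k, hk⟩ : ∃ k, k + 1 = 2 * m := ⟨2 * m - 1, by omega⟩
  rw [← hk] at h5 h6 h7
  exact isRuns_iff_of_lt hk h1 h2 h3 h4 h5 h6 h7

theorem DecompLe.isRuns_iff {r m a b c : ℕ} {g q : ℕ → ℕ} (hm : 1 ≤ m)
    (h : DecompLe r m a b c g q) : IsRuns r (m + 1) g ↔ IsRuns r m q ∧ q 0 ≤ a + c :=
  isRuns_iff_of_le hm h.1 h.2.1 h.2.2.1 h.2.2.2.1 h.2.2.2.2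

theorem IsRuns.exists_decomp {r m : ℕ} {g : ℕ → ℕ} (hm : 1 ≤ m) (H : IsRuns r (m + 1) g) :
    ∃ a b c q, DecompLe r m a b c g q ∨ DecompLt r m a b c g q := by
  have h2 := H.abscissa_even_le (i := 1) (by omega)
  have hlast := H.last
  rw [mul_one, abscissa_two, one_mul] at h2
  rw [add_mul, one_mul] at hlast
  rcases Nat.lt_or_ge (g 0 + g 1 + g (2 * (m + 1))) r with h | h
  · obtain ⟨j, rfl⟩ := Nat.exists_eq_add_of_le' hm
    -- This provides the `r + 1` east steps that are removed from the last run but one.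
    have h3 := H.abscissa_odd_lt (j := j) (d := 1) (by rw [abscissa_two]; omega) le_rfl rfl
    have h4 := abscissa_succ g (2 * (j + 1) + 1)
    rw [show 2 * (j + 1) + 1 + 1 = 2 * (j + 1 + 1) by ring] at h4
    refine ⟨g 0, r - g 0 - g (2 * (j + 1 + 1)), g (2 * (j + 1 + 1)),
      fun i => if i = 0 then g 0 + g 1 + g (2 * (j + 1 + 1)) + 1 else
        if i = 2 * (j + 1) then g (2 * (j + 1) + 1) - (r + 1) else g (i + 1),
      Or.inr ⟨rfl, rfl, by omega, by omega, fun i hi => ?_, ?_, rfl⟩⟩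
    · simp only
      rw [if_neg (by omega), if_neg (by omega)]
    · simp only
      rw [if_neg (by omega), if_true]
      omega
  · refine ⟨g 0, g 1, r - g 0 - g 1,
      fun i => if i = 2 * m then g (2 * m + 2) - (r - g 0 - g 1) else g (i + 2),
      Or.inl ⟨rfl, rfl, by omega, fun i hi => ?_, ?_⟩⟩
    · simp only
      rw [if_neg (by omega)]
    · simp only
      rw [if_true]
      rw [show 2 * (m + 1) = 2 * m + 2 by ring] at h
      omega

/-- The comparison of `q 0` with `a + c` decides which case of `φ` is to be inverted. -/
theorem IsRuns.exists_of_decomp {r m a b c : ℕ} {q : ℕ → ℕ} (hm : 1 ≤ m) (H : IsRuns r m q)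
    (habc : a + b + c = r) :
    ∃ g, IsRuns r (m + 1) g ∧ (DecompLe r m a b c g q ∨ DecompLt r m a b c g q) := by
  rcases Nat.lt_or_ge (a + c) (q 0) with h | h
  · have h1 := H.abscissa_even_le (i := 1) (by omega)
    rw [mul_one, abscissa_two, one_mul] at h1
    -- The value at 1 solves `q 0 = a + g 1 + c + 1`; it is less than `b` because `q 0 ≤ r`.
    have key : DecompLt r m a b c (fun i => if i = 0 then a else if i = 1 then q 0 - a - c - 1
        else if i = 2 * m + 1 then q (2 * m) + (r + 1) else if i = 2 * m + 2 then c
        else q (i - 1)) q := by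
      refine ⟨rfl, ?_, habc, ?_, fun i hi => ?_, ?_, ?_⟩
      · simp only [one_ne_zero, if_false, if_true]
        omega
      · simp only [one_ne_zero, if_false, if_true]
        omega
      · simp only
        rw [if_neg (by omega), if_neg (by omega), if_neg (by omega), if_neg (by omega)]
        rfl
      · simp only
        rw [if_neg (by omega), if_neg (by omega), if_true]
      · simp only
        rw [if_neg (by omega), if_neg (by omega), if_neg (by omega), if_true]
    exact ⟨_, (key.isRuns_iff hm).2 H, Or.inr key⟩
  · have key : DecompLe r m a b c (fun i => if i = 0 then a else if i = 1 then b
        else if i = 2 * m + 2 then q (2 * m) + c else q (i - 2)) q := by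
      refine ⟨rfl, rfl, habc, fun i hi => ?_, ?_⟩
      · simp only
        rw [if_neg (by omega), if_neg (by omega), if_neg (by omega)]
        rfl
      · simp only
        rw [if_neg (by omega), if_neg (by omega), if_true]
    exact ⟨_, (key.isRuns_iff hm).2 ⟨H, h⟩, Or.inl key⟩

/-! ### Bijectivity of `φ` and `Φ` -/

theorem phi_bijOn {r m : ℕ} (hm : 1 ≤ m) :
    Set.BijOn (phi r) (validPaths r 2 (m + 1)) (validPaths r 2 1 ×ˢ validPaths r 2 m) := by
  refine ⟨?_, ?_, ?_⟩
  · intro P hP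
    obtain ⟨g, hg, rfl⟩ := mem_validPaths_iff.1 hP
    obtain ⟨a, b, c, q, h | h⟩ := hg.exists_decomp hm
    · rw [h.phi_eq]
      exact ⟨mem_validPaths_one_iff.2 ⟨a, b, c, h.2.2.1, rfl⟩,
        ofRuns_mem_validPaths.2 ((h.isRuns_iff hm).1 hg).1⟩
    · rw [h.phi_eq hm]
      exact ⟨mem_validPaths_one_iff.2 ⟨a, b, c, h.2.2.1, rfl⟩,
        ofRuns_mem_validPaths.2 ((h.isRuns_iff hm).1 hg)⟩
  · intro P hP P' hP' heq
    obtain ⟨g, hg, rfl⟩ := mem_validPaths_iff.1 hP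
    obtain ⟨g', hg', rfl⟩ := mem_validPaths_iff.1 hP'
    obtain ⟨a, b, c, q, h⟩ := hg.exists_decomp hm
    obtain ⟨a', b', c', q', h'⟩ := hg'.exists_decomp hm
    rw [h.elim (fun h => h.phi_eq) (fun h => h.phi_eq hm),
      h'.elim (fun h => h.phi_eq) (fun h => h.phi_eq hm), Prod.mk.injEq] at heq
    obtain ⟨rfl, rfl, rfl⟩ := tri_inj heq.1
    have hq := ofRuns_inj heq.2
    have hq0 := hq 0 (by omega)
    have hqm := hq (2 * m) le_rfl
    apply ofRuns_congr
    intro i hi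
    -- Within one case the run lengths of `g` are determined by `a`, `b`, `c` and `q`. The mixed
    -- cases contradict each other, one giving `q 0 ≤ a + c` and the other `q 0 > a + c`.
    rcases h with h | h <;> rcases h' with h' | h'
    · obtain ⟨h1, h2, -, h3, h4⟩ := h
      obtain ⟨h1', h2', -, h3', h4'⟩ := h'
      match i with
      | 0 => omega
      | 1 => omega
      | i + 2 =>
        rcases Nat.lt_or_ge i (2 * m) with hi' | hi'
        · rw [h3 i hi', h3' i hi', hq i hi'.le]
        · obtain rfl : i = 2 * m := by omega
          omega
    · have h1 := ((h.isRuns_iff hm).1 hg).2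
      have h2 := h'.2.1
      omega
    · have h1 := ((h'.isRuns_iff hm).1 hg').2
      have h2 := h.2.1
      omega
    · obtain ⟨h1, h2, -, -, h3, h4, h5⟩ := h
      obtain ⟨h1', h2', -, -, h3', h4', h5'⟩ := h'
      match i with
      | 0 => omega
      | 1 => omega
      | i + 2 =>
        rcases Nat.lt_or_ge i (2 * m - 1) with hi' | hi'
        · rw [h3 i hi', h3' i hi', hq (i + 1) (by omega)]
        · rcases (show i + 2 = 2 * m + 1 ∨ i + 2 = 2 * m + 2 by omega) with h6 | h6 <;>
            rw [h6] <;> omega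
  · rintro ⟨T, Q⟩ ⟨hT, hQ⟩
    obtain ⟨a, b, c, habc, rfl⟩ := mem_validPaths_one_iff.1 hT
    obtain ⟨q, hq, rfl⟩ := mem_validPaths_iff.1 hQ
    obtain ⟨g, hg, h⟩ := hq.exists_of_decomp hm habc
    exact ⟨_, ofRuns_mem_validPaths.2 hg, h.elim (fun h => h.phi_eq) (fun h => h.phi_eq hm)⟩

theorem initialE_phi_fst {r m : ℕ} (hm : 1 ≤ m) {P : LatticePath}
    (hP : P ∈ validPaths r 2 (m + 1)) : initialE (phi r P).1 = initialE P := by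
  obtain ⟨g, hg, rfl⟩ := mem_validPaths_iff.1 hP
  rw [initialE_ofRuns]
  obtain ⟨a, b, c, q, h | h⟩ := hg.exists_decomp hm
  · rw [h.phi_eq, initialE_tri, h.1]
  · rw [h.phi_eq hm, initialE_tri, h.1]

theorem initialE_Phi_zero {r m : ℕ} {P : LatticePath} (hP : P ∈ validPaths r 2 (m + 1)) :
    initialE (Phi r (m + 1) P 0) = initialE P := by
  cases m with
  | zero => rfl
  | succ m => exact initialE_phi_fst (by omega) hP

theorem Phi_bijOn (r m : ℕ) :
    Set.BijOn (Phi r (m + 1)) (validPaths r 2 (m + 1))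
      (Set.univ.pi fun _ : Fin (m + 1) => validPaths r 2 1) := by
  induction m with
  | zero =>
    refine ⟨fun P hP i _ => hP, fun P _ P' _ h => congrFun h 0, fun f hf => ?_⟩
    refine ⟨f 0, hf 0 trivial, funext fun i => ?_⟩
    obtain rfl : i = 0 := Fin.ext (by omega)
    rfl
  | succ m ih =>
    have hphi := phi_bijOn (r := r) (m := m + 1) (by omega)
    refine ⟨fun P hP i _ => ?_, fun P hP P' hP' h => ?_, fun f hf => ?_⟩
    · have h := hphi.mapsTo hP
      cases i using Fin.cases with
      | zero => exact h.1
      | succ i => exact ih.mapsTo h.2 i trivial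
    · have h1 : (phi r P).1 = (phi r P').1 := congrFun h 0
      have h2 : Phi r (m + 1) (phi r P).2 = Phi r (m + 1) (phi r P').2 :=
        funext fun i => congrFun h i.succ
      exact hphi.injOn hP hP' (Prod.ext h1
        (ih.injOn (hphi.mapsTo hP).2 (hphi.mapsTo hP').2 h2))
    · obtain ⟨Q, hQ, hQf⟩ := ih.surjOn (show Fin.tail f ∈ _ from fun i _ => hf i.succ trivial)
      obtain ⟨P, hP, hPf⟩ := hphi.surjOn (show (f 0, Q) ∈ _ from ⟨hf 0 trivial, hQ⟩)
      refine ⟨P, hP, ?_⟩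
      rw [Phi, hPf, hQf, Fin.cons_self_tail]

/-! ### Counting -/

theorem east_append_prefix_iff {r m a : ℕ} {P : LatticePath}
    (hP : P ∈ validPaths r 2 (m + 1)) :
    east a ++ [Step.N] <+: P ↔ initialE P = a := by
  constructor
  · rintro ⟨Q, rfl⟩
    rw [List.append_assoc]
    exact initialE_east_append a Q
  · rintro rfl
    obtain ⟨g, -, rfl⟩ := mem_validPaths_iff.1 hP
    rw [initialE_ofRuns, show 2 * (m + 1) = 2 * m + 1 + 1 by ring, ofRuns_succ_eq_cons]
    exact ⟨_, List.append_cons _ _ _ |>.symm⟩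

theorem ncard_validPaths_one_initialE {r a : ℕ} (ha : a ≤ r) :
    {P ∈ validPaths r 2 1 | initialE P = a}.ncard = r - a + 1 := by
  have : {P ∈ validPaths r 2 1 | initialE P = a} =
      (fun b => tri a b (r - a - b)) '' (Finset.range (r - a + 1) : Set ℕ) := by
    ext P
    constructor
    · rintro ⟨hP, h⟩
      obtain ⟨a, b, c, habc, rfl⟩ := mem_validPaths_one_iff.1 hP
      rw [initialE_tri] at h
      subst h
      refine ⟨b, by simp; omega, ?_⟩
      simp only
      rw [show r - a - b = c by omega]
    · rintro ⟨b, hb, rfl⟩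
      simp only [Finset.coe_range, Set.mem_Iio] at hb
      exact ⟨mem_validPaths_one_iff.2 ⟨a, b, r - a - b, by omega, rfl⟩, initialE_tri _ _ _⟩
  rw [this, Set.ncard_image_of_injective _ fun b b' h => (tri_inj h).2.1, Set.ncard_coe_finset,
    Finset.card_range]

/-- The middle run is determined by the outer two, so the pairs `(a, c)` with `a + c ≤ r` are
counted, grouped by their sum. -/
theorem ncard_validPaths_one (r : ℕ) : (validPaths r 2 1).ncard = (r + 2).choose 2 := by
  have : validPaths r 2 1 = (fun x : ℕ × ℕ => tri x.1 (r - x.1 - x.2) x.2) ''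
      ((Finset.range (r + 1)).biUnion Finset.HasAntidiagonal.antidiagonal : Finset (ℕ × ℕ)) := by
    ext P
    rw [mem_validPaths_one_iff]
    constructor
    · rintro ⟨a, b, c, habc, rfl⟩
      refine ⟨(a, c), by simp; omega, ?_⟩
      simp only
      rw [show r - a - c = b by omega]
    · rintro ⟨⟨a, c⟩, h, rfl⟩
      simp at h
      exact ⟨a, r - a - c, c, by omega, rfl⟩
  rw [this, Set.ncard_image_of_injective, Set.ncard_coe_finset, Finset.card_biUnion]
  · simp only [Finset.Nat.card_antidiagonal]
    rw [← Finset.sum_range_succ' (fun i => i) (r + 1) |>.trans (add_zero _),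
      Finset.sum_range_id, Nat.choose_two_right]
  · intro i _ j _ hij
    refine Finset.disjoint_left.2 fun x hx hx' => ?_
    rw [Finset.HasAntidiagonal.mem_antidiagonal] at hx hx'
    omega
  · intro x x' h
    have := tri_inj h
    exact Prod.ext this.1 this.2.2

theorem ncard_validPaths (r m : ℕ) :
    (validPaths r 2 (m + 1)).ncard = (r + 2).choose 2 ^ (m + 1) := by
  induction m with
  | zero => rw [ncard_validPaths_one, zero_add, pow_one]
  | succ m ih =>
    have h := phi_bijOn (r := r) (m := m + 1) (by omega)
    rw [← h.injOn.ncard_image, h.image_eq, Set.ncard_prod, ih,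
      ncard_validPaths_one, pow_succ' _ (m + 1)]

/-- A single application of `φ` suffices: it preserves the initial run, so prescribing `a` restricts
the first factor and leaves the second one free. -/
theorem ncard_validPaths_initialE {r a : ℕ} (m : ℕ) (ha : a ≤ r) :
    {P ∈ validPaths r 2 (m + 1) | initialE P = a}.ncard =
      (r - a + 1) * (r + 2).choose 2 ^ m := by
  cases m with
  | zero => rw [ncard_validPaths_one_initialE ha, pow_zero, mul_one]
  | succ m =>
    have h := phi_bijOn (r := r) (m := m + 1) (by omega)
    have himage : phi r '' {P ∈ validPaths r 2 (m + 1 + 1) | initialE P = a} =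
        {P ∈ validPaths r 2 1 | initialE P = a} ×ˢ validPaths r 2 (m + 1) := by
      ext ⟨T, Q⟩
      constructor
      · rintro ⟨P, ⟨hP, hPa⟩, hPT⟩
        have h1 := h.mapsTo hP
        have h2 := initialE_phi_fst (by omega) hP
        rw [hPT] at h1 h2
        exact ⟨⟨h1.1, h2.trans hPa⟩, h1.2⟩
      · rintro ⟨⟨hT, hTa⟩, hQ⟩
        obtain ⟨P, hP, hPT⟩ := h.surjOn (show (T, Q) ∈ _ from ⟨hT, hQ⟩)
        refine ⟨P, ⟨hP, ?_⟩, hPT⟩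
        rw [← initialE_phi_fst (by omega) hP, hPT]
        exact hTa
    rw [← (h.injOn.mono fun P hP => hP.1).ncard_image, himage, Set.ncard_prod,
      ncard_validPaths_one_initialE ha, ncard_validPaths]

end LatticePaths

theorem mainTheorem2 (r n : ℕ) (hr : 1 ≤ r) (hn : 1 ≤ n) :
    Set.BijOn (LatticePaths.Phi r n) (LatticePaths.validPaths r 2 n)
        (Set.univ.pi fun _ : Fin n => LatticePaths.validPaths r 2 1) ∧
      (∀ P ∈ LatticePaths.validPaths r 2 n,
        LatticePaths.initialE (LatticePaths.Phi r n P ⟨0, hn⟩) = LatticePaths.initialE P) ∧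
      ∀ a : ℕ, a ≤ r →
        {P ∈ LatticePaths.validPaths r 2 n |
            LatticePaths.east a ++ [LatticePaths.Step.N] <+: P}.ncard =
          (r - a + 1) * (r + 2).choose 2 ^ (n - 1) := by
  obtain ⟨m, rfl⟩ := Nat.exists_eq_add_of_le' hn
  refine ⟨LatticePaths.Phi_bijOn r m, fun P hP => LatticePaths.initialE_Phi_zero hP,
    fun a ha => ?_⟩
  rw [Nat.add_sub_cancel, ← LatticePaths.ncard_validPaths_initialE m ha]
  congr 1
  ext P
  exact and_congr_right fun hP => LatticePaths.east_append_prefix_iff hP
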